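/- Let $S^{2n+1}\subset\mathbb C^{n+1}$ be the unit sphere. A CR-curve on $S^{2n+1}$ is a $C^1$ curve $z(s)$ in the sphere all of whose tangents lie in the CR tangent space, i.e. $\sum_j \dot z_j(s)\,\overline{z_j(s)}=0$ for all $s$; its length is its Euclidean length. The Carnot–Carathéodory distance $d_c(p,q)$ is the infimum of the lengths of the CR-curves from $p$ to $q$. Write $1=(1,0,\ldots,0)$, and for $Q=(z_1,\ldots,z_{n+1})\in S^{2n+1}$ write $z_1=\cos\vartheta_1\,e^{i\varphi_1}$ with $0\le\vartheta_1\le\pi/2$ and $-\pi<\varphi_1\le\pi$. For $w\in\mathbb C$ put $$g(w)=\tfrac12\,(w-i\varphi_1)^2-\tfrac12\bigl(\cosh^{-1}(\cos\vartheta_1\cosh w)\bigr)^2 ,$$ where $\cosh^{-1}x=\log\bigl(x+\sqrt{x-1}\,\sqrt{x+1}\bigr)$ is the principal branch. A critical point of $g$ is a point $w\in\mathbb C$ at which $g$ is complex differentiable with $g'(w)=0$. **Theorem 6.14.** Suppose $\vartheta_1=\vartheta_1(Q)\neq0$. Then the infimum defining $d_c(1,Q)$ is attained by a CR-curve from $1$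 to $Q$; and $g$ has a unique critical point of smallest modulus, which is of the form $i\psi$ with $\psi\in\mathbb R$, and $$g(i\psi)=\tfrac12\,d_c(1,Q)^2 .$$ Equivalently, $$d_c(1,Q)^2=\bigl(\cos^{-1}(\cos\vartheta_1\cos\psi)\bigr)^2-(\psi-\varphi_1)^2 ,$$ with $\cos^{-1}$ taking values in $[0,\pi]$. -/

import Mathlib

namespace CRSphere

/-- The space `ℂⁿ⁺¹` with its Hermitian (and Euclidean) structure. -/
abbrev Space (n : ℕ) : Type := EuclideanSpace ℂ (Fin (n + 1))

/-- The base point `1 = (1, 0, …, 0)` of the sphere `S²ⁿ⁺¹`. -/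
noncomputable def basePoint (n : ℕ) : Space n := EuclideanSpace.single 0 1

/-- The Cauchy-Riemann tangent space of the unit sphere at `z`: the complex orthogonal complement
of the holomorphic radial direction `z`. -/
noncomputable def crTangentSpace {n : ℕ} (z : Space n) : Submodule ℂ (Space n) := (ℂ ∙ z)ᗮ

/-- `γ`, restricted to `[0, 1]`, is a CR-curve on the unit sphere `S²ⁿ⁺¹` from `p` to `q`:
a `C¹` curve in the sphere all of whose tangents lie in the CR tangent spaces. -/
structure IsCRCurve {n : ℕ} (p q : Space n) (γ : ℝ → Space n) : Prop where
  contDiffOn : ContDiffOn ℝ 1 γ (Set.Icc 0 1)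
  mem_sphere : ∀ s ∈ Set.Icc (0 : ℝ) 1, γ s ∈ Metric.sphere (0 : Space n) 1
  tangent_mem : ∀ s ∈ Set.Icc (0 : ℝ) 1,
    derivWithin γ (Set.Icc 0 1) s ∈ crTangentSpace (γ s)
  source : γ 0 = p
  target : γ 1 = q

/-- The Euclidean length of the curve `γ` on `[0, 1]`. -/
noncomputable def curveLength {n : ℕ} (γ : ℝ → Space n) : ℝ :=
  ∫ s in (0 : ℝ)..1, ‖derivWithin γ (Set.Icc 0 1) s‖

/-- The set of the lengths of the CR-curves on the sphere from `p` to `q`. -/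
def crLengths {n : ℕ} (p q : Space n) : Set ℝ :=
  {L | ∃ γ : ℝ → Space n, IsCRCurve p q γ ∧ curveLength γ = L}

/-- The Carnot-Caratheodory distance: the infimum of the lengths of the CR-curves
from `p` to `q`. -/
noncomputable def ccDist {n : ℕ} (p q : Space n) : ℝ := sInf (crLengths p q)

/-- The principal branch of the inverse hyperbolic cosine,
`cosh⁻¹ x = log (x + √(x - 1) √(x + 1))`. Its square is holomorphic off the half-line
`(-∞, -1]`, and `cosh⁻¹ x = i cos⁻¹ x` for `-1 < x < 1`. -/
noncomputable def arcosh (x : ℂ) : ℂ :=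
  Complex.log (x + Complex.sqrt (x - 1) * Complex.sqrt (x + 1))

/-- The complex action function
`g(w) = ½ (w - iφ₁)² - ½ (cosh⁻¹ (cos ϑ₁ cosh w))²`. -/
noncomputable def g (ϑ₁ φ₁ : ℝ) (w : ℂ) : ℂ :=
  1 / 2 * (w - Complex.I * (φ₁ : ℂ)) ^ 2
    - 1 / 2 * (arcosh (Complex.cos (ϑ₁ : ℂ) * Complex.cosh w)) ^ 2

/-- `w` is a critical point of `h`: the complex derivative of `h` exists and vanishes at `w`. -/
def IsCriticalPoint (h : ℂ → ℂ) (w : ℂ) : Prop := HasDerivAt h 0 w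

end CRSphere

namespace CRSphere

/-! ### Hyperbolic and trigonometric inequalities excluding off-axis critical points. -/

section RealInequalities

/-! The proof is a duality. Put `c = cos ϑ₁ < 1`. Rotating a CR-curve of length `L` along the Hopf
fibres, with phase `l` times arc length, multiplies its speed by `√(1 + l²)`, since CR directions
are orthogonal to the fibre. The rotated curve is at least as long as the great circle between its
end points. Choosing `l` so that the final phase is `η` gives `arccos (c cos η)² - (η - φ₁)² ≤ L²`
for every real `η` (`arccos_sq_le_curveLength_sq_add`), and the left side is `2 g(iη)`. Conversely,
if `iψ` is critical, the great circle to the rotated end point, rotated back, is itself a CR-curve,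
and its length gives equality at `η = ψ` (`exists_isCRCurve`).

On the imaginary axis, criticality reads `axisMap c η = φ₁`. The map is strictly increasing and
fixes `±π`, so there is exactly one solution, and it lies in `(-π, π]`.

It remains to compare moduli (`norm_lt_of_isCriticalPoint`). A rival off the axis with modulus at
most `|ψ| ≤ π` has imaginary part in `(-π, π)`. If it is real, then `φ₁ = 0`, so `ψ = 0`, and the
rival would be `0`. Otherwise put `cosh a = c cosh w`; the critical equation is `(w - iφ₁) sinh a =
a c sinh w`, and eliminating `Im w - φ₁` leaves one real identity that monotonicity inequalities
contradict (`no_real_solution`). -/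

theorem sinh_lt_self_mul_cosh {x : ℝ} (hx : 0 < x) : Real.sinh x < x * Real.cosh x := by
  have hmono : StrictMonoOn (fun t : ℝ => t * Real.cosh t - Real.sinh t) (Set.Ici 0) := by
    refine strictMonoOn_of_deriv_pos (convex_Ici 0) (by fun_prop) fun t ht => ?_
    rw [interior_Ici, Set.mem_Ioi] at ht
    have hd : HasDerivAt (fun t : ℝ => t * Real.cosh t - Real.sinh t) (t * Real.sinh t) t :=
      (((hasDerivAt_id t).mul (Real.hasDerivAt_cosh t)).sub
        (Real.hasDerivAt_sinh t)).congr_deriv (by simp)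
    rw [hd.deriv]
    exact mul_pos ht (Real.sinh_pos_iff.2 ht)
  have h := hmono (Set.mem_Ici.2 le_rfl) (Set.mem_Ici.2 hx.le) hx
  simp only [Real.sinh_zero, zero_mul, sub_zero] at h
  linarith

/-- The function `sinh t / t` is increasing on the positive half-line. -/
theorem mul_sinh_le_mul_sinh {a b : ℝ} (hb : 0 < b) (hab : b ≤ a) :
    a * Real.sinh b ≤ b * Real.sinh a := by
  have hmono : MonotoneOn (fun t : ℝ => b * Real.sinh t - t * Real.sinh b) (Set.Ici b) := by
    refine monotoneOn_of_deriv_nonneg (convex_Ici b) (by fun_prop)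
      (by fun_prop) fun t ht => ?_
    rw [interior_Ici, Set.mem_Ioi] at ht
    have hd : HasDerivAt (fun t : ℝ => b * Real.sinh t - t * Real.sinh b)
        (b * Real.cosh t - 1 * Real.sinh b) t :=
      ((Real.hasDerivAt_sinh t).const_mul b).sub ((hasDerivAt_id t).mul_const _)
    rw [hd.deriv]
    have h1 := sinh_lt_self_mul_cosh hb
    have h2 : Real.cosh b ≤ Real.cosh t :=
      Real.cosh_le_cosh.2 (by rw [abs_of_pos hb, abs_of_pos (hb.trans ht)]; exact ht.le)
    nlinarith
  have h := hmono (Set.mem_Ici.2 le_rfl) (Set.mem_Ici.2 hab) hab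
  simp only at h
  linarith

/-- The function `t coth t` is increasing on the positive half-line. -/
theorem mul_cosh_mul_sinh_le {p x : ℝ} (hp : 0 < p) (hpx : p < x) :
    p * Real.cosh p * Real.sinh x ≤ x * Real.sinh p * Real.cosh x := by
  -- Comparing `sinh t / t` at `x - p` and `x + p` and expanding by the addition formulas gives the
  -- claim exactly.
  have h := mul_sinh_le_mul_sinh (a := x + p) (b := x - p) (by linarith) (by linarith)
  rw [Real.sinh_sub, Real.sinh_add] at h
  nlinarith

/-- The function `tanh t (t - tanh t)` is increasing on the positive half-line. -/
theorem tanh_mul_sub_lt {p x : ℝ} (hp : 0 < p) (hpx : p < x) :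
    p * Real.cosh x ^ 2 * Real.sinh p * Real.cosh p + Real.sinh x ^ 2 - Real.sinh p ^ 2
      < x * Real.cosh p ^ 2 * Real.sinh x * Real.cosh x := by
  have hd : 0 < x - p := by linarith
  have hCx := Real.one_le_cosh x
  have hCp := Real.one_le_cosh p
  have hSp := Real.sinh_pos_iff.2 hp
  have h1 : Real.sinh (x - p) < (x - p) * Real.cosh (x - p) := sinh_lt_self_mul_cosh hd
  have h2 : Real.cosh (x - p) ≤ Real.cosh x * Real.cosh p := by
    rw [Real.cosh_sub]
    have := mul_pos (Real.sinh_pos_iff.2 (hp.trans hpx)) hSp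
    linarith
  have h3 : Real.sinh (x - p) < (x - p) * (Real.cosh x * Real.cosh p) :=
    h1.trans_le (mul_le_mul_of_nonneg_left h2 hd.le)
  have h4 : 0 < Real.sinh (x - p) := Real.sinh_pos_iff.2 hd
  rw [Real.sinh_sub] at h3 h4
  have hxp : Real.sinh p < p * Real.cosh p := sinh_lt_self_mul_cosh hp
  have hxx : Real.sinh x < x * Real.cosh x := sinh_lt_self_mul_cosh (hp.trans hpx)
  have e1 := Real.cosh_sq x
  have e2 := Real.cosh_sq p
  set Sx := Real.sinh x
  set Cx := Real.cosh x
  set Sp := Real.sinh p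
  set Cp := Real.cosh p
  -- The right-hand products of `k1` and `k2` add up to the difference of the two sides of the goal,
  -- by `e3`.
  have k1 : 0 < (Sx * Cp - Cx * Sp) * ((x * Cx - Sx) * Cp) :=
    mul_pos h4 (mul_pos (by linarith) (by linarith))
  have k2 : 0 < (Sp * Cx) * ((x - p) * (Cx * Cp) - (Sx * Cp - Cx * Sp)) :=
    mul_pos (mul_pos hSp (by linarith)) (by linarith)
  have e3 : Sx ^ 2 * Cp ^ 2 - Sp ^ 2 * Cx ^ 2 = Sx ^ 2 - Sp ^ 2 := by
    rw [e1, e2]; ring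
  nlinarith

theorem mul_cos_lt_sin {t : ℝ} (h0 : 0 < t) (h1 : t < Real.pi) : t * Real.cos t < Real.sin t := by
  have hmono : StrictMonoOn (fun t : ℝ => Real.sin t - t * Real.cos t) (Set.Icc 0 Real.pi) := by
    refine strictMonoOn_of_deriv_pos (convex_Icc _ _) (by fun_prop) fun t ht => ?_
    rw [interior_Icc] at ht
    have hd : HasDerivAt (fun t : ℝ => Real.sin t - t * Real.cos t) (t * Real.sin t) t :=
      ((Real.hasDerivAt_sin t).sub
        ((hasDerivAt_id t).mul (Real.hasDerivAt_cos t))).congr_deriv (by simp)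
    rw [hd.deriv]
    exact mul_pos ht.1 (Real.sin_pos_of_pos_of_lt_pi ht.1 ht.2)
  have h := hmono ⟨le_rfl, Real.pi_pos.le⟩ ⟨h0.le, h1.le⟩ h0
  simp only [Real.sin_zero, zero_mul, sub_zero] at h
  linarith

theorem mul_sin_mul_cos_le {q : ℝ} (h0 : -Real.pi ≤ q) (h1 : q ≤ Real.pi) :
    q * Real.sin q * Real.cos q ≤ Real.sin q ^ 2 := by
  have key : ∀ t : ℝ, 0 ≤ t → t ≤ Real.pi → t * Real.sin t * Real.cos t ≤ Real.sin t ^ 2 := by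
    intro t ht ht'
    have hs := Real.sin_nonneg_of_nonneg_of_le_pi ht ht'
    rcases ht.eq_or_lt with rfl | h
    · simp
    rcases ht'.eq_or_lt with rfl | h'
    · simp
    have := mul_cos_lt_sin h h'
    nlinarith
  rcases le_total 0 q with h | h
  · exact key q h h1
  · have := key (-q) (by linarith) (by linarith)
    simpa using this

/-- The vanishing of the real part of the critical point equation, after elimination of the
imaginary part, is impossible off the imaginary axis. -/
theorem no_real_solution {c x y p q m : ℝ} (hc0 : 0 < c) (hc1 : c < 1) (hx : 0 < x) (hp : 0 < p)
    (hq0 : -Real.pi ≤ q) (hq1 : q ≤ Real.pi) (hq : Real.sin q ≠ 0)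
    (hre : Real.cosh p * Real.cos q = c * (Real.cosh x * Real.cos y))
    (him : Real.sinh p * Real.sin q = c * (Real.sinh x * Real.sin y))
    (e1 : x * (Real.sinh p * Real.cos q) - m * (Real.cosh p * Real.sin q)
      = c * (p * (Real.sinh x * Real.cos y) - q * (Real.cosh x * Real.sin y)))
    (e2 : x * (Real.cosh p * Real.sin q) + m * (Real.sinh p * Real.cos q)
      = c * (p * (Real.cosh x * Real.sin y) + q * (Real.sinh x * Real.cos y))) : False := by
  have hSx := Real.sinh_pos_iff.2 hx
  have hSp := Real.sinh_pos_iff.2 hp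
  have hCx := Real.cosh_pos x
  have hCp := Real.cosh_pos p
  -- If `x ≤ p`, then `hre` and `him` bound `cos² q` and `sin² q` by `(c cos y)²` and `(c sin y)²`;
  -- summing gives `1 ≤ c²`.
  have hpx : p < x := by
    by_contra hcon
    push Not at hcon
    have h1 : Real.sinh x ≤ Real.sinh p := Real.sinh_le_sinh.2 hcon
    have h2 : Real.cosh x ≤ Real.cosh p :=
      Real.cosh_le_cosh.2 (by rw [abs_of_pos hx, abs_of_pos hp]; exact hcon)
    have a1 : Real.cos q ^ 2 ≤ (c * Real.cos y) ^ 2 := by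
      have : Real.cosh x ^ 2 * Real.cos q ^ 2 ≤ Real.cosh x ^ 2 * (c * Real.cos y) ^ 2 := by
        calc Real.cosh x ^ 2 * Real.cos q ^ 2 ≤ Real.cosh p ^ 2 * Real.cos q ^ 2 := by gcongr
          _ = (Real.cosh p * Real.cos q) ^ 2 := by ring
          _ = _ := by rw [hre]; ring
      exact le_of_mul_le_mul_left this (by positivity)
    have a2 : Real.sin q ^ 2 ≤ (c * Real.sin y) ^ 2 := by
      have : Real.sinh x ^ 2 * Real.sin q ^ 2 ≤ Real.sinh x ^ 2 * (c * Real.sin y) ^ 2 := by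
        calc Real.sinh x ^ 2 * Real.sin q ^ 2 ≤ Real.sinh p ^ 2 * Real.sin q ^ 2 := by gcongr
          _ = (Real.sinh p * Real.sin q) ^ 2 := by ring
          _ = _ := by rw [him]; ring
      exact le_of_mul_le_mul_left this (by positivity)
    have b1 := Real.sin_sq_add_cos_sq q
    have b2 := Real.sin_sq_add_cos_sq y
    have b3 : (c * Real.cos y) ^ 2 + (c * Real.sin y) ^ 2 = c ^ 2 := by
      linear_combination c ^ 2 * b2
    nlinarith
  have i1 := mul_cosh_mul_sinh_le hp hpx
  have i2 := tanh_mul_sub_lt hp hpx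
  have i3 := mul_sin_mul_cos_le hq0 hq1
  have hSS : Real.sinh p < Real.sinh x := Real.sinh_lt_sinh.2 hpx
  have hs2 : 0 < Real.sin q ^ 2 := by positivity
  have f1 := Real.cosh_sq x
  have f2 := Real.cosh_sq p
  -- `sinh p cos q` times `e1` plus `cosh p sin q` times `e2` cancels `m`; `hre` and `him` then
  -- remove `y` and `c`.
  have elim : x * (Real.cosh p ^ 2 * Real.sin q ^ 2 + Real.sinh p ^ 2 * Real.cos q ^ 2)
        * (Real.sinh x * Real.cosh x)
      = p * Real.sinh p * Real.cosh p
          * (Real.sinh x ^ 2 * Real.cos q ^ 2 + Real.cosh x ^ 2 * Real.sin q ^ 2)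
        + q * Real.sin q * Real.cos q * (Real.sinh x ^ 2 - Real.sinh p ^ 2) := by
    generalize Real.sinh x = Sx at *
    generalize Real.cosh x = Cx at *
    generalize Real.sinh p = Sp at *
    generalize Real.cosh p = Cp at *
    generalize Real.sin q = sq at *
    generalize Real.cos q = cq at *
    generalize Real.sin y = sy at *
    generalize Real.cos y = cy at *
    linear_combination (Sx * Cx * Sp * cq) * e1 + (Sx * Cx * Cp * sq) * e2
      - (p * Sx ^ 2 * Sp * cq + q * Sx ^ 2 * Cp * sq) * hre
      - (p * Cx ^ 2 * Cp * sq - q * Cx ^ 2 * Sp * cq) * him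
      + q * sq * cq * (Sx ^ 2 * f2 - Sp ^ 2 * f1)
  generalize Real.sinh x = Sx at *
  generalize Real.cosh x = Cx at *
  generalize Real.sinh p = Sp at *
  generalize Real.cosh p = Cp at *
  have j1 : 0 ≤ Real.cos q ^ 2 * (Sp * Sx) * (x * Sp * Cx - p * Cp * Sx) :=
    mul_nonneg (by positivity) (by linarith)
  have j2 : 0 < Real.sin q ^ 2 * (x * Cp ^ 2 * Sx * Cx
      - (p * Cx ^ 2 * Sp * Cp + Sx ^ 2 - Sp ^ 2)) := mul_pos hs2 (by linarith)
  have j3 : 0 ≤ (Real.sin q ^ 2 - q * Real.sin q * Real.cos q) * (Sx ^ 2 - Sp ^ 2) :=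
    mul_nonneg (by linarith) (by nlinarith)
  nlinarith

end RealInequalities

/-! ### A branch of `arcosh` adapted to the imaginary axis. -/

section Arcosh

theorem sqrt_sq (x : ℂ) : Complex.sqrt x ^ 2 = x := by
  rw [Complex.sqrt]
  exact_mod_cast Complex.cpow_nat_inv_pow x (n := 2) two_ne_zero

theorem hasDerivAt_sqrt {x : ℂ} (hx : x ∈ Complex.slitPlane) :
    HasDerivAt Complex.sqrt (1 / (2 * Complex.sqrt x)) x := by
  have hx0 : x ≠ 0 := Complex.slitPlane_ne_zero hx
  have h0 : Complex.sqrt x ≠ 0 := fun h => hx0 (by rw [← sqrt_sq x, h]; simp)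
  have h : HasDerivAt (fun z : ℂ => z ^ (2⁻¹ : ℂ)) ((2⁻¹ : ℂ) * x ^ ((2⁻¹ : ℂ) - 1) * 1) x :=
    (hasDerivAt_id x).cpow_const hx
  refine h.congr_deriv ?_
  rw [Complex.cpow_sub _ _ hx0, Complex.cpow_one, mul_one]
  change 2⁻¹ * (Complex.sqrt x / x) = _
  nth_rewrite 2 [← sqrt_sq x]
  field_simp

/-- The number `sinh (log (u + sinhLog u)) = i √(1 - u²)`. -/
noncomputable def sinhLog (u : ℂ) : ℂ := Complex.I * Complex.sqrt (1 - u ^ 2)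

theorem sinhLog_sq (u : ℂ) : sinhLog u ^ 2 = u ^ 2 - 1 := by
  rw [sinhLog, mul_pow, sqrt_sq, Complex.I_sq]; ring

theorem add_sinhLog_mul (u : ℂ) : (u + sinhLog u) * (u - sinhLog u) = 1 := by
  linear_combination -sinhLog_sq u

theorem add_sinhLog_ne_zero (u : ℂ) : u + sinhLog u ≠ 0 :=
  left_ne_zero_of_mul_eq_one (add_sinhLog_mul u)

theorem inv_add_sinhLog (u : ℂ) : (u + sinhLog u)⁻¹ = u - sinhLog u :=
  inv_eq_of_mul_eq_one_right (add_sinhLog_mul u)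

theorem sinhLog_ne_zero {u : ℂ} (hu : 1 - u ^ 2 ∈ Complex.slitPlane) : sinhLog u ≠ 0 := by
  intro h
  have := sinhLog_sq u
  rw [h] at this
  exact Complex.slitPlane_ne_zero hu (by linear_combination this)

/-- If `u + sinhLog u` were a real `r`, its inverse `u - sinhLog u` would be real too, hence so
would `sinhLog u`, and `1 - u² = -(sinhLog u)²` would be nonpositive. -/
theorem add_sinhLog_mem_slitPlane {u : ℂ} (hu : 1 - u ^ 2 ∈ Complex.slitPlane) :
    u + sinhLog u ∈ Complex.slitPlane := by
  by_contra hcon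
  rw [Complex.mem_slitPlane_iff_not_le_zero, not_not] at hcon
  obtain ⟨r, hr⟩ : ∃ r : ℝ, u + sinhLog u = r :=
    ⟨_, (Complex.ext rfl (by simpa using (Complex.le_def.1 hcon).2))⟩
  have hi := inv_add_sinhLog u
  have hT : sinhLog u = (((r - r⁻¹) / 2 : ℝ) : ℂ) := by
    push_cast; rw [← hr, hi]; ring
  have h1 : 1 - u ^ 2 = ((-((r - r⁻¹) / 2) ^ 2 : ℝ) : ℂ) := by
    have := sinhLog_sq u
    rw [hT] at this
    push_cast at this ⊢
    linear_combination this
  rw [h1, Complex.ofReal_mem_slitPlane] at hu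
  nlinarith [sq_nonneg ((r - r⁻¹) / 2)]

/-- The two square roots of `u² - 1` agree up to sign. A change of sign inverts the argument of the
logarithm and so negates the logarithm, which squaring hides. -/
theorem arcosh_sq {u : ℂ} (hu : 1 - u ^ 2 ∈ Complex.slitPlane) :
    arcosh u ^ 2 = Complex.log (u + sinhLog u) ^ 2 := by
  rw [arcosh]
  have h : (Complex.sqrt (u - 1) * Complex.sqrt (u + 1)) ^ 2 = sinhLog u ^ 2 := by
    rw [mul_pow, sqrt_sq, sqrt_sq, sinhLog_sq]; ring
  rcases sq_eq_sq_iff_eq_or_eq_neg.1 h with h | h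
  · rw [h]
  · rw [h, ← sub_eq_add_neg, ← inv_add_sinhLog,
      Complex.log_inv _ (Complex.mem_slitPlane_iff_arg.1 (add_sinhLog_mem_slitPlane hu)).1, neg_sq]

theorem hasDerivAt_log_add_sinhLog {u : ℂ} (hu : 1 - u ^ 2 ∈ Complex.slitPlane) :
    HasDerivAt (fun v : ℂ => Complex.log (v + sinhLog v)) (1 / sinhLog u) u := by
  have h1 : HasDerivAt (fun v : ℂ => 1 - v ^ 2) (-(2 * u)) u := by
    simpa using (hasDerivAt_pow 2 u).const_sub 1
  have h2 : HasDerivAt (fun v : ℂ => v + Complex.I * Complex.sqrt (1 - v ^ 2)) _ u :=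
    (hasDerivAt_id u).add
      (HasDerivAt.const_mul Complex.I (HasDerivAt.comp u (hasDerivAt_sqrt hu) h1))
  refine (h2.clog (add_sinhLog_mem_slitPlane hu)).congr_deriv ?_
  have h0 := add_sinhLog_ne_zero u
  have h3 := sinhLog_ne_zero hu
  have h4 : Complex.sqrt (1 - u ^ 2) ≠ 0 := fun h => h3 (by rw [sinhLog, h, mul_zero])
  rw [sinhLog] at h0 h3 ⊢
  rw [div_eq_div_iff h0 h3]
  field_simp
  linear_combination (-u) * Complex.I_sq

theorem cosh_log_add_sinhLog (u : ℂ) : Complex.cosh (Complex.log (u + sinhLog u)) = u := by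
  rw [Complex.cosh, Complex.exp_neg, Complex.exp_log (add_sinhLog_ne_zero u), inv_add_sinhLog]
  ring

theorem sinh_log_add_sinhLog (u : ℂ) :
    Complex.sinh (Complex.log (u + sinhLog u)) = sinhLog u := by
  rw [Complex.sinh, Complex.exp_neg, Complex.exp_log (add_sinhLog_ne_zero u), inv_add_sinhLog]
  ring

theorem one_sub_sq_mem_slitPlane_of_im_ne_zero {u : ℂ} (hu : u.im ≠ 0) :
    1 - u ^ 2 ∈ Complex.slitPlane := by
  rw [Complex.mem_slitPlane_iff]
  by_cases h : u.re = 0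
  · left
    simp only [sq, Complex.sub_re, Complex.one_re, Complex.mul_re, h]
    nlinarith [mul_self_nonneg u.im]
  · right
    simp only [sq, Complex.sub_im, Complex.one_im, Complex.mul_im]
    intro h'
    have : u.re * u.im = 0 := by linarith
    exact (mul_ne_zero h hu) this

theorem one_sub_sq_mem_slitPlane_of_abs_lt_one {t : ℝ} (ht : |t| < 1) :
    1 - (t : ℂ) ^ 2 ∈ Complex.slitPlane := by
  have : 1 - (t : ℂ) ^ 2 = ((1 - t ^ 2 : ℝ) : ℂ) := by push_cast; ring
  rw [this, Complex.ofReal_mem_slitPlane]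
  linarith [(sq_lt_one_iff_abs_lt_one t).2 ht]

theorem sinhLog_ofReal {t : ℝ} (ht : |t| ≤ 1) :
    sinhLog t = Complex.I * (Real.sqrt (1 - t ^ 2) : ℝ) := by
  have h : 1 - (t : ℂ) ^ 2 = ((1 - t ^ 2 : ℝ) : ℂ) := by push_cast; ring
  have h0 : 0 ≤ 1 - t ^ 2 := by linarith [(sq_le_one_iff_abs_le_one t).2 ht]
  rw [sinhLog, h, Complex.sqrt_of_nonneg (by exact_mod_cast h0), Complex.ofReal_re]

theorem log_add_sinhLog_ofReal {t : ℝ} (ht : |t| ≤ 1) :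
    Complex.log (t + sinhLog t) = Complex.I * (Real.arccos t : ℝ) := by
  have h := abs_le.1 ht
  have h1 : (t : ℂ) + sinhLog t = Complex.exp ((Real.arccos t : ℝ) * Complex.I) := by
    rw [Complex.exp_mul_I, ← Complex.ofReal_cos, ← Complex.ofReal_sin, Real.cos_arccos h.1 h.2,
      Real.sin_arccos, sinhLog_ofReal ht, mul_comm Complex.I]
  have hpi := Real.pi_pos
  rw [h1, Complex.log_exp, mul_comm]
  · simpa using by linarith [Real.arccos_nonneg t]
  · simpa using Real.arccos_le_pi t

theorem arcosh_sq_ofReal {t : ℝ} (ht : |t| < 1) :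
    arcosh t ^ 2 = ((-(Real.arccos t) ^ 2 : ℝ) : ℂ) := by
  rw [arcosh_sq (one_sub_sq_mem_slitPlane_of_abs_lt_one ht), log_add_sinhLog_ofReal ht.le, mul_pow,
    Complex.I_sq]
  push_cast; ring

theorem arcosh_sq_im_eq_zero {t : ℝ} (ht : 0 ≤ t) : (arcosh t ^ 2).im = 0 := by
  rcases lt_or_ge t 1 with h | h
  · rw [arcosh_sq_ofReal (by rwa [abs_of_nonneg ht]), Complex.ofReal_im]
  · have h1 : (t : ℂ) - 1 = ((t - 1 : ℝ) : ℂ) := by push_cast; ring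
    have h2 : (t : ℂ) + 1 = ((t + 1 : ℝ) : ℂ) := by push_cast; ring
    rw [arcosh, h1, h2, Complex.sqrt_of_nonneg (by exact_mod_cast sub_nonneg.2 h),
      Complex.sqrt_of_nonneg (by exact_mod_cast (by linarith : 0 ≤ t + 1))]
    simp only [Complex.ofReal_re]
    rw [← Complex.ofReal_mul, ← Complex.ofReal_add, ← Complex.ofReal_log (by positivity),
      ← Complex.ofReal_pow, Complex.ofReal_im]

end Arcosh

/-! ### The critical point equation off the imaginary axis. -/

section CriticalPoints

theorem hasDerivAt_g (ϑ φ : ℝ) {w : ℂ}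
    (hw : 1 - (Complex.cos ϑ * Complex.cosh w) ^ 2 ∈ Complex.slitPlane) :
    HasDerivAt (g ϑ φ) ((w - Complex.I * φ)
      - Complex.log (Complex.cos ϑ * Complex.cosh w + sinhLog (Complex.cos ϑ * Complex.cosh w))
        * (Complex.cos ϑ * Complex.sinh w) / sinhLog (Complex.cos ϑ * Complex.cosh w)) w := by
  have h1 : HasDerivAt (fun z : ℂ => 1 / 2 * (z - Complex.I * φ) ^ 2) (w - Complex.I * φ) w :=
    ((((hasDerivAt_id w).sub_const (Complex.I * φ)).pow 2).const_mul (1 / 2 : ℂ)).congr_deriv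
      (by simp)
  have h2 : HasDerivAt (fun z : ℂ => Complex.cos ϑ * Complex.cosh z)
      (Complex.cos ϑ * Complex.sinh w) w := (Complex.hasDerivAt_cosh w).const_mul _
  have h3 := ((((hasDerivAt_log_add_sinhLog hw).comp w h2).pow 2).const_mul (1 / 2 : ℂ))
  refine ((h1.sub h3).congr_of_eventuallyEq ?_).congr_deriv ?_
  · have hopen : IsOpen {z : ℂ | 1 - (Complex.cos ϑ * Complex.cosh z) ^ 2 ∈ Complex.slitPlane} :=
      Complex.isOpen_slitPlane.preimage
        (by fun_prop : Continuous fun z : ℂ => 1 - (Complex.cos ϑ * Complex.cosh z) ^ 2)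
    filter_upwards [hopen.mem_nhds hw] with z hz
    simp only [g, arcosh_sq hz, Pi.sub_apply, Pi.pow_apply, Function.comp_apply]
  · simp only [Function.comp_apply]
    ring

theorem critical_equation {ϑ φ : ℝ} {w : ℂ}
    (hw : 1 - (Complex.cos ϑ * Complex.cosh w) ^ 2 ∈ Complex.slitPlane)
    (hcrit : IsCriticalPoint (g ϑ φ) w) :
    (w - Complex.I * φ) * sinhLog (Complex.cos ϑ * Complex.cosh w)
      = Complex.log (Complex.cos ϑ * Complex.cosh w + sinhLog (Complex.cos ϑ * Complex.cosh w))
        * (Complex.cos ϑ * Complex.sinh w) := by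
  have h := (hasDerivAt_g ϑ φ hw).unique hcrit
  have h0 := sinhLog_ne_zero hw
  field_simp at h
  linear_combination h

/-- On the real line `arcosh²` is real here, so `Im g(t) = -φ t`, whose slope must vanish. This
avoids differentiating the branch where `c cosh t ≥ 1`. -/
theorem eq_zero_of_isCriticalPoint_ofReal {ϑ φ x : ℝ} (hϑ : 0 ≤ Real.cos ϑ)
    (hcrit : IsCriticalPoint (g ϑ φ) x) : φ = 0 := by
  have h1 : HasDerivAt (fun t : ℝ => (g ϑ φ t).im) 0 x :=
    (Complex.imCLM.hasFDerivAt.comp_hasDerivAt x hcrit.comp_ofReal).congr_deriv (by simp)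
  have h2 : (fun t : ℝ => (g ϑ φ t).im) = fun t => -φ * t := by
    funext t
    have h3 := arcosh_sq_im_eq_zero (mul_nonneg hϑ (Real.cosh_pos t).le)
    push_cast at h3
    have h4 : ((t : ℂ) - Complex.I * φ) ^ 2 =
        ((t ^ 2 - φ ^ 2 : ℝ) : ℂ) + ((-2 * t * φ : ℝ) : ℂ) * Complex.I := by
      push_cast
      linear_combination (φ : ℂ) ^ 2 * Complex.I_sq
    have h5 : (1 / 2 : ℂ) = ((1 / 2 : ℝ) : ℂ) := by push_cast; rfl
    rw [g, h4, h5, Complex.sub_im, Complex.im_ofReal_mul, Complex.im_ofReal_mul, h3]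
    simp only [Complex.add_im, Complex.ofReal_im, Complex.im_ofReal_mul, Complex.I_im]
    ring
  rw [h2] at h1
  have h3 := h1.unique ((hasDerivAt_id x).const_mul (-φ))
  linarith

theorem not_isCriticalPoint {ϑ φ x y : ℝ} (hϑ : 0 ≤ Real.cos ϑ) (hϑ1 : Real.cos ϑ < 1)
    (hx : x ≠ 0) (hy : Real.sin y ≠ 0) :
    ¬ IsCriticalPoint (g ϑ φ) (x + y * Complex.I) := by
  intro hcrit
  set c := Real.cos ϑ with hc
  set w : ℂ := x + y * Complex.I with hwdef
  have hcosh : Complex.cosh w = ((Real.cosh x * Real.cos y : ℝ) : ℂ)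
      + ((Real.sinh x * Real.sin y : ℝ) : ℂ) * Complex.I := by
    rw [hwdef, Complex.cosh_add, Complex.cosh_mul_I, Complex.sinh_mul_I]
    push_cast; ring
  have hsinh : Complex.sinh w = ((Real.sinh x * Real.cos y : ℝ) : ℂ)
      + ((Real.cosh x * Real.sin y : ℝ) : ℂ) * Complex.I := by
    rw [hwdef, Complex.sinh_add, Complex.cosh_mul_I, Complex.sinh_mul_I]
    push_cast; ring
  have hcc : Complex.cos ϑ = (c : ℂ) := (Complex.ofReal_cos ϑ).symm
  have hSx : Real.sinh x ≠ 0 := fun h => hx (Real.sinh_eq_zero.1 h)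
  -- For `c = 0` the equation collapses to `w = iφ`, contradicting `x ≠ 0`.
  rcases hϑ.eq_or_lt with h0 | h0
  · have hw : 1 - (Complex.cos ϑ * Complex.cosh w) ^ 2 ∈ Complex.slitPlane := by
      rw [hcc, ← h0]; simp
    have h := critical_equation hw hcrit
    have h1 := sinhLog_ne_zero hw
    rw [hcc, ← h0] at h h1
    simp only [Complex.ofReal_zero, zero_mul, mul_zero, mul_eq_zero] at h h1
    rcases h with h | h
    · have := congrArg Complex.re h
      simp [hwdef] at this
      exact hx this
    · exact h1 h
  · set u : ℂ := Complex.cos ϑ * Complex.cosh w with hu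
    have hu' : u = ((c * (Real.cosh x * Real.cos y) : ℝ) : ℂ)
        + ((c * (Real.sinh x * Real.sin y) : ℝ) : ℂ) * Complex.I := by
      rw [hu, hcosh, hcc]; push_cast; ring
    have huim : u.im ≠ 0 := by
      rw [hu', Complex.add_im, Complex.ofReal_im, Complex.im_ofReal_mul, Complex.I_im]
      simp only [zero_add, mul_one]
      exact mul_ne_zero h0.ne' (mul_ne_zero hSx hy)
    have heq := critical_equation (one_sub_sq_mem_slitPlane_of_im_ne_zero huim) hcrit
    rw [← hu, hcc, hsinh] at heq
    have hco := cosh_log_add_sinhLog u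
    have hsi := sinh_log_add_sinhLog u
    have hq0 := Complex.neg_pi_lt_log_im (u + sinhLog u)
    have hq1 := Complex.log_im_le_pi (u + sinhLog u)
    set a := Complex.log (u + sinhLog u)
    rw [← hsi] at heq
    clear_value a
    set p := a.re
    set q := a.im
    have ha : a = (p : ℂ) + (q : ℂ) * Complex.I := (Complex.re_add_im a).symm
    have hcosha : Complex.cosh a = ((Real.cosh p * Real.cos q : ℝ) : ℂ)
        + ((Real.sinh p * Real.sin q : ℝ) : ℂ) * Complex.I := by
      rw [ha, Complex.cosh_add, Complex.cosh_mul_I, Complex.sinh_mul_I]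
      push_cast; ring
    have hsinha : Complex.sinh a = ((Real.sinh p * Real.cos q : ℝ) : ℂ)
        + ((Real.cosh p * Real.sin q : ℝ) : ℂ) * Complex.I := by
      rw [ha, Complex.sinh_add, Complex.cosh_mul_I, Complex.sinh_mul_I]
      push_cast; ring
    rw [hcosha, hu'] at hco
    have hre := congrArg Complex.re hco
    have him := congrArg Complex.im hco
    simp only [Complex.add_re, Complex.add_im, Complex.ofReal_re, Complex.ofReal_im,
      Complex.re_ofReal_mul, Complex.im_ofReal_mul, Complex.I_re, Complex.I_im, mul_zero, mul_one,
      add_zero, zero_add] at hre him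
    rw [hsinha, ha, hwdef] at heq
    have e1 := congrArg Complex.re heq
    have e2 := congrArg Complex.im heq
    simp only [Complex.add_re, Complex.add_im, Complex.sub_re, Complex.sub_im, Complex.mul_re,
      Complex.mul_im, Complex.ofReal_re, Complex.ofReal_im, Complex.I_re, Complex.I_im, mul_zero,
      mul_one, add_zero, zero_add, sub_zero, zero_mul, one_mul] at e1 e2
    have hpq : Real.sinh p * Real.sin q ≠ 0 := by
      rw [him]; exact mul_ne_zero h0.ne' (mul_ne_zero hSx hy)
    have hp : p ≠ 0 := fun h => hpq (by simp [h])
    have hq : Real.sin q ≠ 0 := right_ne_zero_of_mul hpq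
    -- The symmetries `w ↦ -w`, `a ↦ -a` and simultaneous reflection in the imaginary axis reduce to
    -- `x, p > 0`. Replacing `q` by `-q` is why `no_real_solution` allows `q = -π`.
    rcases hx.lt_or_gt with hx' | hx' <;> rcases hp.lt_or_gt with hp' | hp'
    · refine no_real_solution (x := -x) (y := y) (p := -p) (q := q) (m := y - φ) h0 hϑ1
        (by linarith) (by linarith) hq0.le hq1 hq ?_ ?_ ?_ ?_ <;>
        simp only [Real.cosh_neg, Real.sinh_neg] <;> linarith
    · refine no_real_solution (x := -x) (y := -y) (p := p) (q := q) (m := -(y - φ)) h0 hϑ1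
        (by linarith) (by linarith) hq0.le hq1 hq ?_ ?_ ?_ ?_ <;>
        simp only [Real.cosh_neg, Real.sinh_neg, Real.sin_neg, Real.cos_neg] <;> linarith
    · refine no_real_solution (x := x) (y := y) (p := -p) (q := -q) (m := (y - φ)) h0 hϑ1
        (by linarith) (by linarith) (by linarith) (by linarith) (by simpa using hq) ?_ ?_ ?_ ?_ <;>
        simp only [Real.cosh_neg, Real.sinh_neg, Real.sin_neg, Real.cos_neg] <;> linarith
    · exact no_real_solution (x := x) (y := y) (p := p) (q := q) (m := (y - φ)) h0 hϑ1
        hx' hp' hq0.le hq1 hq (by linarith) (by linarith) (by linarith) (by linarith)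

end CriticalPoints

/-! ### Critical points on the imaginary axis and minimality of the modulus. -/

section ImaginaryAxis

/-- The derivative of the action function along the imaginary axis is `φ - axisMap c η`. -/
noncomputable def axisMap (c η : ℝ) : ℝ :=
  η - Real.arccos (c * Real.cos η) * (c * Real.sin η) / Real.sqrt (1 - (c * Real.cos η) ^ 2)

theorem abs_mul_cos_lt_one {c : ℝ} (hc0 : 0 ≤ c) (hc1 : c < 1) (η : ℝ) :
    |c * Real.cos η| < 1 := by
  rw [abs_mul, abs_of_nonneg hc0]
  nlinarith [Real.abs_cos_le_one η, abs_nonneg (Real.cos η)]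

/-- With `cos α = c cos η` and `R = sin α`, the derivative factors as `(1 - c² sin² η / R²)(1 - α
cos α / sin α)`. The first factor is positive because `c < 1`, the second because `α cos α < sin α`
on `(0, π)`. -/
theorem strictMono_axisMap {c : ℝ} (hc0 : 0 ≤ c) (hc1 : c < 1) : StrictMono (axisMap c) := by
  have key : ∀ η, ∃ f', HasDerivAt (axisMap c) f' η ∧ 0 < f' := by
    intro η
    have hlt := abs_lt.1 (abs_mul_cos_lt_one hc0 hc1 η)
    have hpos : 0 < 1 - (c * Real.cos η) ^ 2 := by nlinarith
    set R := Real.sqrt (1 - (c * Real.cos η) ^ 2) with hR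
    have hRpos : 0 < R := Real.sqrt_pos.2 hpos
    have hR2 : R ^ 2 = 1 - (c * Real.cos η) ^ 2 := Real.sq_sqrt hpos.le
    set α := Real.arccos (c * Real.cos η) with hα
    have hsin : Real.sin α = R := Real.sin_arccos _
    have hcos : Real.cos α = c * Real.cos η := Real.cos_arccos hlt.1.le hlt.2.le
    have hαpos : 0 < α := Real.arccos_pos.2 hlt.2
    have hαlt : α < Real.pi := by
      refine lt_of_le_of_ne (Real.arccos_le_pi _) fun h => ?_
      rw [h, Real.sin_pi] at hsin
      exact hRpos.ne hsin
    have d1 : HasDerivAt (fun t : ℝ => c * Real.cos t) (c * -Real.sin η) η :=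
      (Real.hasDerivAt_cos η).const_mul c
    have d2 := (Real.hasDerivAt_arccos (ne_of_gt hlt.1) (ne_of_lt hlt.2)).comp η d1
    have d3 : HasDerivAt (fun t : ℝ => c * Real.sin t) (c * Real.cos η) η :=
      (Real.hasDerivAt_sin η).const_mul c
    have d4 := ((d1.pow 2).const_sub 1).sqrt hpos.ne'
    have d5 := (hasDerivAt_id η).sub ((d2.mul d3).div d4 hRpos.ne')
    refine ⟨(1 - (c * Real.sin η) ^ 2 / R ^ 2) * (1 - α * (c * Real.cos η) / R),
      d5.congr_deriv ?_, mul_pos ?_ ?_⟩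
    · simp only [Function.comp_apply, Pi.mul_apply, Pi.pow_apply, ← hR, ← hα]
      field_simp
      ring
    · rw [sub_pos, div_lt_one (by positivity), hR2]
      have h1 : (c * Real.sin η) ^ 2 + (c * Real.cos η) ^ 2 = c ^ 2 := by
        linear_combination c ^ 2 * Real.sin_sq_add_cos_sq η
      nlinarith
    · rw [sub_pos, div_lt_one hRpos, ← hcos, ← hsin]
      exact mul_cos_lt_sin hαpos hαlt
  exact strictMono_of_hasDerivAt_pos (fun η => (key η).choose_spec.1)
    (fun η => (key η).choose_spec.2)

theorem axisMap_pi (c : ℝ) : axisMap c Real.pi = Real.pi := by simp [axisMap]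

theorem axisMap_neg_pi (c : ℝ) : axisMap c (-Real.pi) = -Real.pi := by simp [axisMap]

theorem exists_axisMap_eq {c φ : ℝ} (hc0 : 0 ≤ c) (hc1 : c < 1) (h0 : -Real.pi < φ)
    (h1 : φ ≤ Real.pi) : ∃ ψ, -Real.pi < ψ ∧ ψ ≤ Real.pi ∧ axisMap c ψ = φ := by
  have hcont : Continuous (axisMap c) := by
    refine continuous_id.sub (Continuous.div ?_ ?_ fun η => ?_)
    · exact (Real.continuous_arccos.comp (by fun_prop)).mul (by fun_prop)
    · fun_prop
    · have hlt := abs_lt.1 (abs_mul_cos_lt_one hc0 hc1 η)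
      exact (Real.sqrt_pos.2 (by nlinarith)).ne'
  have hpi := Real.pi_pos
  have h := intermediate_value_Icc (by linarith : -Real.pi ≤ Real.pi) hcont.continuousOn
  rw [axisMap_pi, axisMap_neg_pi] at h
  obtain ⟨ψ, hψ, rfl⟩ := h ⟨h0.le, h1⟩
  refine ⟨ψ, lt_of_le_of_ne hψ.1 fun h => ?_, hψ.2, rfl⟩
  rw [← h, axisMap_neg_pi] at h0
  exact lt_irrefl _ h0

theorem hasDerivAt_g_I_mul {ϑ : ℝ} (φ η : ℝ) (hc0 : 0 ≤ Real.cos ϑ) (hc1 : Real.cos ϑ < 1) :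
    HasDerivAt (g ϑ φ) (Complex.I * ((axisMap (Real.cos ϑ) η - φ : ℝ) : ℂ)) (Complex.I * η) := by
  have hlt := abs_mul_cos_lt_one hc0 hc1 η
  have hu : Complex.cos ϑ * Complex.cosh (Complex.I * η)
      = ((Real.cos ϑ * Real.cos η : ℝ) : ℂ) := by
    rw [mul_comm Complex.I, Complex.cosh_mul_I]; push_cast; ring
  have hw := one_sub_sq_mem_slitPlane_of_abs_lt_one hlt
  rw [← hu] at hw
  refine (hasDerivAt_g ϑ φ hw).congr_deriv ?_
  have h0 := sinhLog_ne_zero hw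
  rw [hu] at h0 ⊢
  rw [sinhLog_ofReal hlt.le] at h0
  rw [log_add_sinhLog_ofReal hlt.le, sinhLog_ofReal hlt.le, mul_comm Complex.I (η : ℂ),
    Complex.sinh_mul_I, axisMap]
  have h1 := right_ne_zero_of_mul h0
  push_cast at h1 ⊢
  field_simp
  ring

theorem isCriticalPoint_I_mul_iff {ϑ φ η : ℝ} (hc0 : 0 ≤ Real.cos ϑ) (hc1 : Real.cos ϑ < 1) :
    IsCriticalPoint (g ϑ φ) (Complex.I * η) ↔ axisMap (Real.cos ϑ) η = φ := by
  have h := hasDerivAt_g_I_mul φ η hc0 hc1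
  constructor
  · intro hcrit
    have := h.unique hcrit
    simpa [Complex.I_ne_zero, sub_eq_zero, ← Complex.ofReal_sub] using this
  · intro heq
    rw [heq, sub_self, Complex.ofReal_zero, mul_zero] at h
    exact h

theorem g_I_mul {ϑ : ℝ} (φ η : ℝ) (hc0 : 0 ≤ Real.cos ϑ) (hc1 : Real.cos ϑ < 1) :
    g ϑ φ (Complex.I * η) =
      ((1 / 2 * (Real.arccos (Real.cos ϑ * Real.cos η) ^ 2 - (η - φ) ^ 2) : ℝ) : ℂ) := by
  have hu : Complex.cos ϑ * Complex.cosh (Complex.I * η)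
      = ((Real.cos ϑ * Real.cos η : ℝ) : ℂ) := by
    rw [mul_comm Complex.I, Complex.cosh_mul_I]; push_cast; ring
  rw [g, hu, arcosh_sq_ofReal (abs_mul_cos_lt_one hc0 hc1 η)]
  push_cast
  linear_combination (1 / 2 * ((η : ℂ) - φ) ^ 2) * Complex.I_sq

theorem norm_lt_of_isCriticalPoint {ϑ φ ψ : ℝ} (hc0 : 0 ≤ Real.cos ϑ) (hc1 : Real.cos ϑ < 1)
    (hψ : |ψ| ≤ Real.pi) (hφ : axisMap (Real.cos ϑ) ψ = φ) {w : ℂ}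
    (hw : IsCriticalPoint (g ϑ φ) w) (hne : w ≠ Complex.I * ψ) : ‖Complex.I * (ψ : ℂ)‖ < ‖w‖ := by
  rw [norm_mul, Complex.norm_I, one_mul, Complex.norm_real, Real.norm_eq_abs]
  by_contra hcon
  push Not at hcon
  have hwre : w = w.re + w.im * Complex.I := (Complex.re_add_im w).symm
  by_cases hx : w.re = 0
  · have hwI : w = Complex.I * w.im := by
      rw [hx] at hwre
      rw [hwre]; simp [mul_comm]
    rw [hwI, isCriticalPoint_I_mul_iff hc0 hc1] at hw
    exact hne (by rw [hwI, (strictMono_axisMap hc0 hc1).injective (hw.trans hφ.symm)])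
  · have hy : |w.im| < Real.pi := (Complex.abs_im_lt_norm.2 hx).trans_le (hcon.trans hψ)
    by_cases hs : Real.sin w.im = 0
    · have hy0 : w.im = 0 := by
        rw [abs_lt] at hy
        exact (Real.sin_eq_zero_iff_of_lt_of_lt hy.1 hy.2).1 hs
      rw [hy0, Complex.ofReal_zero, zero_mul, add_zero] at hwre
      rw [hwre] at hw
      have hφ0 := eq_zero_of_isCriticalPoint_ofReal hc0 hw
      have hψ0 : ψ = 0 := by
        refine (strictMono_axisMap hc0 hc1).injective (a₂ := 0) ?_
        rw [hφ, hφ0]; simp [axisMap]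
      rw [hψ0, abs_zero, norm_le_zero_iff] at hcon
      exact hx (by rw [hcon, Complex.zero_re])
    · rw [hwre] at hw
      exact not_isCriticalPoint hc0 hc1 hx hs hw

end ImaginaryAxis

/-! ### Lower bound for the length by Hopf rotation. -/

section LowerBound

/-- On the unit sphere the function `Re ⟪e, ·⟫` varies along a tangent vector at most as fast as
along the great circle through `e`. -/
theorem re_inner_sq_le {E : Type*} [NormedAddCommGroup E] [InnerProductSpace ℂ E] {e x v : E}
    (he : ‖e‖ = 1) (hx : ‖x‖ = 1) (hv : (inner ℂ x v).re = 0) :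
    (inner ℂ e v).re ^ 2 ≤ ‖v‖ ^ 2 * (1 - (inner ℂ e x).re ^ 2) := by
  set t := (inner ℂ e x).re with ht
  have h1 : (inner ℂ e v).re = (inner ℂ (e - (t : ℂ) • x) v).re := by
    rw [inner_sub_left, inner_smul_left, Complex.sub_re, Complex.conj_ofReal,
      Complex.re_ofReal_mul, hv, mul_zero, sub_zero]
  have h2 : ‖e - (t : ℂ) • x‖ ^ 2 = 1 - t ^ 2 := by
    rw [norm_sub_sq (𝕜 := ℂ), inner_smul_right, norm_smul, he, hx, Complex.norm_real]
    simp only [RCLike.re_to_complex, Complex.re_ofReal_mul, ← ht, mul_one, Real.norm_eq_abs,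
      sq_abs]
    ring
  have h3 : |(inner ℂ (e - (t : ℂ) • x) v).re| ≤ ‖e - (t : ℂ) • x‖ * ‖v‖ :=
    (Complex.abs_re_le_norm _).trans (norm_inner_le_norm _ _)
  rw [h1, ← h2, ← sq_abs, mul_comm, ← mul_pow]
  gcongr

theorem norm_basePoint (n : ℕ) : ‖basePoint n‖ = 1 := by simp [basePoint]

theorem inner_basePoint {n : ℕ} (z : Space n) : inner ℂ (basePoint n) z = z 0 := by
  simp [basePoint, EuclideanSpace.inner_single_left]

/-- The vector `ω (i l ‖v‖ z + v)` is the velocity of the Hopf-rotated curve. Its two components are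
orthogonal, so its norm is `√(1 + l²) ‖v‖`, and `re_inner_sq_le` applies. -/
theorem re_coord_sq_le {n : ℕ} {z v : Space n} {ω : ℂ} (l : ℝ) (hz : ‖z‖ = 1) (hω : ‖ω‖ = 1)
    (hv : inner ℂ z v = 0) :
    (ω * (Complex.I * (l * ‖v‖ : ℝ) * z 0 + v 0)).re ^ 2
      ≤ (Real.sqrt (1 + l ^ 2) * ‖v‖) ^ 2 * (1 - (ω * z 0).re ^ 2) := by
  have hzz : inner ℂ z z = (1 : ℂ) := by rw [inner_self_eq_norm_sq_to_K, hz]; simp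
  set v' : Space n := (Complex.I * (l * ‖v‖ : ℝ)) • z + v with hv'
  have hωω : (starRingEnd ℂ) ω * ω = 1 := by
    rw [← Complex.normSq_eq_conj_mul_self, Complex.normSq_eq_norm_sq, hω]; simp
  have h1 : (inner ℂ (ω • z) (ω • v')).re = 0 := by
    rw [inner_smul_left, inner_smul_right, ← mul_assoc, hωω, one_mul, hv', inner_add_right,
      inner_smul_right, hv, hzz, add_zero, mul_one]
    simp
  have h2 : ‖ω • v'‖ ^ 2 = (Real.sqrt (1 + l ^ 2) * ‖v‖) ^ 2 := by
    rw [norm_smul, hω, one_mul, mul_pow, Real.sq_sqrt (by positivity), hv',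
      norm_add_sq (𝕜 := ℂ), inner_smul_left, hv, mul_zero, norm_smul, hz, norm_mul, Complex.norm_I,
      Complex.norm_real, Real.norm_eq_abs, one_mul, mul_one, sq_abs]
    simp
    ring
  have h := re_inner_sq_le (norm_basePoint n) (x := ω • z) (v := ω • v')
    (by rw [norm_smul, hω, hz, one_mul]) h1
  rw [h2, inner_basePoint, inner_basePoint] at h
  have h3 : (ω • v') 0 = ω * (Complex.I * (l * ‖v‖ : ℝ) * z 0 + v 0) := by simp [hv', mul_add]
  have h4 : (ω • z) 0 = ω * z 0 := rfl
  rwa [h3, h4] at h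

theorem arccos_le_mul_curveLength {n : ℕ} {Q : Space n} {γ : ℝ → Space n}
    (hγ : IsCRCurve (basePoint n) Q γ) (l : ℝ) :
    Real.arccos (Complex.exp (Complex.I * (l * curveLength γ : ℝ)) * Q 0).re
      ≤ Real.sqrt (1 + l ^ 2) * curveLength γ := by
  set γ' := derivWithin γ (Set.Icc 0 1) with hγ'
  have hcont : ContinuousOn (fun s => ‖γ' s‖) (Set.Icc 0 1) :=
    (hγ.contDiffOn.continuousOn_derivWithin (uniqueDiffOn_Icc zero_lt_one) le_rfl).norm
  -- Extending the speed continuously to `ℝ` makes the arc length `N` differentiable everywhere.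
  set V : ℝ → ℝ := Set.IccExtend zero_le_one ((Set.Icc (0 : ℝ) 1).domRestrict fun s => ‖γ' s‖)
  have hVcont : Continuous V := (continuousOn_iff_continuous_domRestrict.1 hcont).Icc_extend'
  have hV : ∀ s ∈ Set.Icc (0 : ℝ) 1, V s = ‖γ' s‖ := fun s hs => Set.IccExtend_of_mem _ _ hs
  set N : ℝ → ℝ := fun s => ∫ r in (0 : ℝ)..s, V r
  have hN : ∀ s, HasDerivAt N (V s) s := fun s => (hVcont.integral_hasStrictDerivAt 0 s).hasDerivAt
  have hNcont : Continuous N := continuous_iff_continuousAt.2 fun s => (hN s).continuousAt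
  have hN0 : N 0 = 0 := intervalIntegral.integral_same
  have hN1 : N 1 = curveLength γ := by
    refine intervalIntegral.integral_congr fun s hs => ?_
    rw [Set.uIcc_of_le zero_le_one] at hs
    exact hV s hs
  set ω : ℝ → ℂ := fun s => Complex.exp (Complex.I * (l * N s : ℝ))
  have hω : ∀ s, ‖ω s‖ = 1 := fun s => by
    simp only [ω]
    rw [mul_comm, Complex.norm_exp_ofReal_mul_I]
  have hωcont : Continuous ω := by fun_prop
  set t : ℝ → ℝ := fun s => (ω s * γ s 0).re with ht
  have hcoord : ∀ s, ‖γ s‖ = 1 → |t s| ≤ 1 := fun s hs => by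
    refine (Complex.abs_re_le_norm _).trans ?_
    rw [norm_mul, hω, one_mul, ← hs]
    exact PiLp.norm_apply_le _ _
  set K := Real.sqrt (1 + l ^ 2)
  have hK : 0 ≤ K := Real.sqrt_nonneg _
  have hγ0cont : ContinuousOn (fun s => γ s 0) (Set.Icc 0 1) :=
    (EuclideanSpace.proj (𝕜 := ℂ) (0 : Fin (n + 1))).continuous.comp_continuousOn
      hγ.contDiffOn.continuousOn
  have htcont : ContinuousOn t (Set.Icc 0 1) :=
    Complex.continuous_re.comp_continuousOn (hωcont.continuousOn.mul hγ0cont)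
  -- `arccos` is not differentiable at `±1`, and the curve starts at `t = 1`. Damping by `κ < 1`
  -- avoids this; `κ → 1` restores the bound.
  have main : ∀ κ : ℝ, 0 < κ → κ < 1 →
      Real.arccos (κ * t 1) - Real.arccos (κ * t 0) ≤ K * N 1 := by
    intro κ hκ0 hκ1
    have hderiv : ∀ s ∈ interior (Set.Icc (0 : ℝ) 1), ∃ d,
        HasDerivAt (fun s => K * N s - Real.arccos (κ * t s)) d s ∧ 0 ≤ d := by
      intro s hs
      have hs' := interior_subset hs
      rw [interior_Icc] at hs
      have hnorm : ‖γ s‖ = 1 := mem_sphere_zero_iff_norm.1 (hγ.mem_sphere s hs')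
      have hd : HasDerivAt γ (γ' s) s :=
        ((hγ.contDiffOn.differentiableOn one_ne_zero s hs').hasDerivWithinAt).hasDerivAt
          (Icc_mem_nhds hs.1 hs.2)
      have hd0 : HasDerivAt (fun s => γ s 0) (γ' s 0) s :=
        ((EuclideanSpace.proj (𝕜 := ℂ) (0 : Fin (n + 1))).restrictScalars
          ℝ).hasFDerivAt.comp_hasDerivAt s hd
      have hdω : HasDerivAt ω (ω s * (Complex.I * (l * V s : ℝ))) s :=
        ((((hN s).const_mul l).ofReal_comp).const_mul Complex.I).cexp
      have hdt : HasDerivAt t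
          (ω s * (Complex.I * (l * V s : ℝ) * γ s 0 + γ' s 0)).re s :=
        (Complex.reCLM.hasFDerivAt.comp_hasDerivAt s (hdω.mul hd0)).congr_deriv (by
          rw [Complex.reCLM_apply]; congr 1; ring)
      have horth : inner ℂ (γ s) (γ' s) = 0 :=
        Submodule.mem_orthogonal_singleton_iff_inner_right.1 (hγ.tangent_mem s hs')
      have hbound := re_coord_sq_le l hnorm (hω s) horth
      rw [← hV s hs'] at hbound
      set t' := (ω s * (Complex.I * (l * V s : ℝ) * γ s 0 + γ' s 0)).re
      change t' ^ 2 ≤ (K * V s) ^ 2 * (1 - t s ^ 2) at hbound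
      have ht1 := abs_le.1 (hcoord s hnorm)
      have hκt : |κ * t s| < 1 := by
        rw [abs_mul, abs_of_pos hκ0]
        nlinarith [hcoord s hnorm, abs_nonneg (t s)]
      have hκt' := abs_lt.1 hκt
      have hpos : 0 < 1 - (κ * t s) ^ 2 := by nlinarith
      have hda := (Real.hasDerivAt_arccos (ne_of_gt hκt'.1) (ne_of_lt hκt'.2)).comp s
        (hdt.const_mul κ)
      refine ⟨_, ((hN s).const_mul K).sub hda, ?_⟩
      have hR := Real.sqrt_pos.2 hpos
      have hR2 := Real.sq_sqrt hpos.le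
      set R := Real.sqrt (1 - (κ * t s) ^ 2)
      have hVs : 0 ≤ V s := by rw [hV s hs']; exact norm_nonneg _
      have hle : -(κ * t') ≤ K * V s * R := by
        refine (neg_le_abs _).trans (abs_le_of_sq_le_sq ?_ (by positivity))
        calc (κ * t') ^ 2 = κ ^ 2 * t' ^ 2 := by ring
          _ ≤ κ ^ 2 * ((K * V s) ^ 2 * (1 - t s ^ 2)) := by gcongr
          _ = (K * V s) ^ 2 * (κ ^ 2 - (κ * t s) ^ 2) := by ring
          _ ≤ (K * V s) ^ 2 * (1 - (κ * t s) ^ 2) := by gcongr; nlinarith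
          _ = (K * V s * R) ^ 2 := by rw [← hR2]; ring
      have : -(1 / R) * (κ * t') ≤ K * V s := by
        rw [neg_mul, one_div, ← mul_neg, inv_mul_le_iff₀ hR]
        linarith
      linarith
    have hmono : MonotoneOn (fun s => K * N s - Real.arccos (κ * t s)) (Set.Icc 0 1) := by
      refine monotoneOn_of_deriv_nonneg (convex_Icc 0 1) ?_ ?_ ?_
      · exact (hNcont.const_mul K).continuousOn.sub
          (Real.continuous_arccos.comp_continuousOn (continuousOn_const.mul htcont))
      · intro s hs
        obtain ⟨d, hd, -⟩ := hderiv s hs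
        exact hd.differentiableAt.differentiableWithinAt
      · intro s hs
        obtain ⟨d, hd, hd0⟩ := hderiv s hs
        rwa [hd.deriv]
    have h := hmono ⟨le_rfl, zero_le_one⟩ ⟨zero_le_one, le_rfl⟩ zero_le_one
    simp only [hN0, mul_zero] at h
    linarith
  have ht0 : t 0 = 1 := by
    simp [ht, ω, hN0, hγ.source, basePoint]
  have hlim : Filter.Tendsto (fun κ : ℝ => Real.arccos (κ * t 1) - Real.arccos (κ * t 0))
      (nhdsWithin 1 (Set.Iio 1)) (nhds (Real.arccos (t 1))) := by
    have hc : Continuous fun κ : ℝ => Real.arccos (κ * t 1) - Real.arccos (κ * t 0) :=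
      (Real.continuous_arccos.comp (by fun_prop)).sub (Real.continuous_arccos.comp (by fun_prop))
    have := hc.continuousWithinAt (s := Set.Iio 1) (x := 1)
    have h1 : Real.arccos (1 * t 1) - Real.arccos (1 * t 0) = Real.arccos (t 1) := by
      rw [one_mul, one_mul, ht0, Real.arccos_one, sub_zero]
    rwa [ContinuousWithinAt, h1] at this
  have hfin := le_of_tendsto hlim (b := K * N 1) (by
    filter_upwards [Ioo_mem_nhdsLT (zero_lt_one : (0 : ℝ) < 1)] with κ hκ
    exact main κ hκ.1 hκ.2)
  simpa only [ht, ω, hN1, hγ.target] using hfin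

theorem curveLength_nonneg {n : ℕ} (γ : ℝ → Space n) : 0 ≤ curveLength γ :=
  intervalIntegral.integral_nonneg zero_le_one fun _ _ => norm_nonneg _

/-- Duality bound: rotating a CR-curve along the Hopf fibration yields a spherical curve to a
rotated end point, which is at least as long as the great circle. -/
theorem arccos_sq_le_curveLength_sq_add {n : ℕ} {Q : Space n} {γ : ℝ → Space n}
    (hγ : IsCRCurve (basePoint n) Q γ) {c φ : ℝ} (hc0 : 0 ≤ c) (hc1 : c < 1)
    (hQ : Q 0 = c * Complex.exp (Complex.I * φ)) (η : ℝ) :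
    Real.arccos (c * Real.cos η) ^ 2 ≤ curveLength γ ^ 2 + (η - φ) ^ 2 := by
  have hre : ∀ r : ℝ, (Complex.exp (Complex.I * r) * Q 0).re = c * Real.cos (r + φ) := by
    intro r
    rw [hQ, mul_left_comm, ← Complex.exp_add, ← mul_add, ← Complex.ofReal_add, mul_comm Complex.I,
      Complex.re_ofReal_mul, Complex.exp_ofReal_mul_I_re]
  have hbound : ∀ l : ℝ, Real.arccos (c * Real.cos (l * curveLength γ + φ))
      ≤ Real.sqrt (1 + l ^ 2) * curveLength γ := fun l => by
    rw [← hre]; exact arccos_le_mul_curveLength hγ l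
  -- The unrotated case `l = 0` suffices, since `c < 1` keeps the end point away from the base
  -- point.
  have hpos : 0 < curveLength γ := by
    have h := hbound 0
    have h1 : 0 < Real.arccos (c * Real.cos (0 * curveLength γ + φ)) :=
      Real.arccos_pos.2 (abs_lt.1 (abs_mul_cos_lt_one hc0 hc1 _)).2
    simp only [ne_eq, OfNat.ofNat_ne_zero, not_false_eq_true, zero_pow, add_zero, Real.sqrt_one,
      one_mul] at h
    linarith
  set L := curveLength γ
  have h := hbound ((η - φ) / L)
  rw [div_mul_cancel₀ _ hpos.ne', sub_add_cancel] at h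
  calc Real.arccos (c * Real.cos η) ^ 2
      ≤ (Real.sqrt (1 + ((η - φ) / L) ^ 2) * L) ^ 2 :=
        pow_le_pow_left₀ (Real.arccos_nonneg _) h 2
    _ = (1 + ((η - φ) / L) ^ 2) * L ^ 2 := by rw [mul_pow, Real.sq_sqrt (by positivity)]
    _ = L ^ 2 + (η - φ) ^ 2 := by field_simp

end LowerBound

/-! ### A CR-curve attaining the bound. -/

section Minimizer

/-- The great circle through `e` and `v`, rotated along the Hopf fibration. -/
noncomputable def rotatedCircle {n : ℕ} (e v : Space n) (α β s : ℝ) : Space n :=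
  Complex.exp (-(Complex.I * (β * s : ℝ))) •
    (((Real.cos (α * s) : ℝ) : ℂ) • e + ((Real.sin (α * s) : ℝ) : ℂ) • v)

theorem norm_exp_neg_I_mul (r : ℝ) : ‖Complex.exp (-(Complex.I * r))‖ = 1 := by
  rw [← mul_neg, ← Complex.ofReal_neg, mul_comm, Complex.norm_exp_ofReal_mul_I]

theorem hasDerivAt_rotatedCircle {n : ℕ} (e v : Space n) (α β s : ℝ) :
    HasDerivAt (rotatedCircle e v α β) (Complex.exp (-(Complex.I * (β * s : ℝ))) •
      ((((α * -Real.sin (α * s) : ℝ) : ℂ) • e + ((α * Real.cos (α * s) : ℝ) : ℂ) • v)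
      - (Complex.I * β) •
        (((Real.cos (α * s) : ℝ) : ℂ) • e + ((Real.sin (α * s) : ℝ) : ℂ) • v))) s := by
  have h0 : ∀ a : ℝ, HasDerivAt (fun r : ℝ => a * r) a s := fun a => by
    simpa using (hasDerivAt_id s).const_mul a
  have hc := ((h0 α).cos.ofReal_comp).smul_const e
  have hs := ((h0 α).sin.ofReal_comp).smul_const v
  have he := (((h0 β).ofReal_comp).const_mul Complex.I).neg.cexp
  refine (he.smul (hc.add hs)).congr_deriv ?_
  simp only [Pi.add_apply, Pi.neg_apply]
  rw [smul_sub, smul_smul (Complex.exp _) (Complex.I * (β : ℂ)), mul_neg, neg_smul,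
    mul_comm (-Real.sin (α * s)), mul_comm (Real.cos (α * s)) α, sub_eq_add_neg]

theorem contDiff_rotatedCircle {n : ℕ} (e v : Space n) (α β : ℝ) :
    ContDiff ℝ 1 (rotatedCircle e v α β) := by
  have hofReal : ContDiff ℝ 1 ((↑) : ℝ → ℂ) := Complex.ofRealCLM.contDiff
  have hlin : ∀ a : ℝ, ContDiff ℝ 1 fun s : ℝ => a * s := fun a => by fun_prop
  have h1 : ContDiff ℝ 1 fun s : ℝ => Complex.exp (-(Complex.I * (β * s : ℝ))) :=
    (contDiff_const.mul (hofReal.comp (hlin β))).neg.cexp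
  exact h1.smul (((hofReal.comp (hlin α).cos).smul contDiff_const).add
    ((hofReal.comp (hlin α).sin).smul contDiff_const))

/-- The great circle has constant speed `α` and constant Hopf component `α τ`. Unwinding at the rate
`β = α τ` removes precisely that component, leaving a CR-curve of speed `√(α² - β²)`. -/
theorem isCRCurve_rotatedCircle {n : ℕ} {e v : Space n} {α β τ : ℝ} (he : ‖e‖ = 1) (hv : ‖v‖ = 1)
    (hev : inner ℂ e v = Complex.I * τ) (hβ : β = α * τ) :
    IsCRCurve e (rotatedCircle e v α β 1) (rotatedCircle e v α β) ∧
      curveLength (rotatedCircle e v α β) = Real.sqrt (α ^ 2 - β ^ 2) := by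
  have hee : inner ℂ e e = (1 : ℂ) := by rw [inner_self_eq_norm_sq_to_K, he]; simp
  have hvv : inner ℂ v v = (1 : ℂ) := by rw [inner_self_eq_norm_sq_to_K, hv]; simp
  have hve : inner ℂ v e = -(Complex.I * τ) := by
    rw [← inner_conj_symm, hev]; simp
  have hsc : ∀ s : ℝ, ((Real.sin s : ℝ) : ℂ) ^ 2 + ((Real.cos s : ℝ) : ℂ) ^ 2 = 1 := fun s => by
    exact_mod_cast Real.sin_sq_add_cos_sq s
  have hd : ∀ s ∈ Set.Icc (0 : ℝ) 1, derivWithin (rotatedCircle e v α β) (Set.Icc 0 1) s = _ :=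
    fun s hs => (hasDerivAt_rotatedCircle e v α β s).hasDerivWithinAt.derivWithin
      (uniqueDiffOn_Icc zero_lt_one s hs)
  have hexp : ∀ r : ℝ, (starRingEnd ℂ) (Complex.exp (-(Complex.I * r)))
      * Complex.exp (-(Complex.I * r)) = 1 := fun r => by
    rw [← Complex.normSq_eq_conj_mul_self, Complex.normSq_eq_norm_sq, norm_exp_neg_I_mul]; simp
  refine ⟨⟨(contDiff_rotatedCircle e v α β).contDiffOn, fun s _ => ?_, fun s hs => ?_, ?_, rfl⟩, ?_⟩
  · rw [mem_sphere_zero_iff_norm, rotatedCircle, norm_smul, norm_exp_neg_I_mul, one_mul,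
      ← sq_eq_sq₀ (norm_nonneg _) zero_le_one, one_pow]
    have : ((‖((Real.cos (α * s) : ℝ) : ℂ) • e + ((Real.sin (α * s) : ℝ) : ℂ) • v‖ ^ 2 : ℝ) : ℂ)
        = 1 := by
      rw [Complex.ofReal_pow]
      refine (inner_self_eq_norm_sq_to_K (𝕜 := ℂ) (E := Space n) _).symm.trans ?_
      simp only [inner_add_left, inner_add_right, inner_smul_left, inner_smul_right, hee, hvv, hev,
        hve, Complex.conj_ofReal]
      linear_combination hsc (α * s)
    exact_mod_cast this
  · rw [crTangentSpace, Submodule.mem_orthogonal_singleton_iff_inner_right, hd s hs, rotatedCircle,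
      inner_smul_left, inner_smul_right, ← mul_assoc, hexp, one_mul]
    simp only [inner_add_left, inner_add_right, inner_sub_right, inner_smul_left, inner_smul_right,
      hee, hvv, hev, hve, Complex.conj_ofReal, hβ]
    push_cast [-Complex.ofReal_sin, -Complex.ofReal_cos]
    ring
  · simp [rotatedCircle]
  · have hspeed : ∀ s ∈ Set.Icc (0 : ℝ) 1,
        ‖derivWithin (rotatedCircle e v α β) (Set.Icc 0 1) s‖ = Real.sqrt (α ^ 2 - β ^ 2) := by
      intro s hs
      rw [hd s hs, norm_smul, norm_exp_neg_I_mul, one_mul]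
      rw [← Real.sqrt_sq (norm_nonneg _)]
      congr 1
      rw [← Complex.ofReal_inj, Complex.ofReal_pow]
      refine (inner_self_eq_norm_sq_to_K (𝕜 := ℂ) (E := Space n) _).symm.trans ?_
      simp only [inner_add_left, inner_add_right, inner_sub_left, inner_sub_right, inner_smul_left,
        inner_smul_right, hee, hvv, hev, hve, Complex.conj_ofReal, map_mul, Complex.conj_I, hβ]
      push_cast [-Complex.ofReal_sin, -Complex.ofReal_cos]
      generalize hS : ((Real.sin (α * s) : ℝ) : ℂ) = S
      generalize hC : ((Real.cos (α * s) : ℝ) : ℂ) = C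
      have h1 : S ^ 2 + C ^ 2 = 1 := by rw [← hS, ← hC]; exact hsc _
      linear_combination ((α : ℂ) ^ 2 + Complex.I ^ 2 * α ^ 2 * τ ^ 2) * h1
        + (α : ℂ) ^ 2 * τ ^ 2 * Complex.I_sq
    rw [curveLength, intervalIntegral.integral_congr (g := fun _ => Real.sqrt (α ^ 2 - β ^ 2))
      (fun s hs => hspeed s (by rwa [Set.uIcc_of_le zero_le_one] at hs))]
    simp

/-- At a critical value of the parameter, the great circle to the rotated end point, rotated back,
is a CR-curve to `Q`. -/
theorem exists_isCRCurve {n : ℕ} {Q : Space n} (hQn : ‖Q‖ = 1) {c φ ψ : ℝ} (hc0 : 0 ≤ c)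
    (hc1 : c < 1) (hQ : Q 0 = c * Complex.exp (Complex.I * φ)) (hψ : axisMap c ψ = φ) :
    ∃ γ, IsCRCurve (basePoint n) Q γ ∧
      curveLength γ = Real.sqrt (Real.arccos (c * Real.cos ψ) ^ 2 - (ψ - φ) ^ 2) := by
  have hlt := abs_lt.1 (abs_mul_cos_lt_one hc0 hc1 ψ)
  set α := Real.arccos (c * Real.cos ψ) with hα
  set β := ψ - φ with hβdef
  have hcos : Real.cos α = c * Real.cos ψ := Real.cos_arccos hlt.1.le hlt.2.le
  have hsin : Real.sin α = Real.sqrt (1 - (c * Real.cos ψ) ^ 2) := Real.sin_arccos _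
  have hsinpos : 0 < Real.sin α := by
    rw [hsin]; exact Real.sqrt_pos.2 (by nlinarith)
  -- This is the critical equation, read as the matching of the unwinding rate with the Hopf
  -- component of the great circle.
  have hβ : β = α * (c * Real.sin ψ / Real.sin α) := by
    rw [hβdef, ← hψ, axisMap, ← hsin, ← hα]; ring
  set P : Space n := Complex.exp (Complex.I * β) • Q with hP
  set e := basePoint n with he
  -- The initial direction of the great circle to `P`, so that `P = cos α • e + sin α • v`.
  set v : Space n := ((Real.sin α : ℝ) : ℂ)⁻¹ • (P - ((Real.cos α : ℝ) : ℂ) • e) with hv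
  have hsin0 : ((Real.sin α : ℝ) : ℂ) ≠ 0 := by exact_mod_cast hsinpos.ne'
  have hPn : ‖P‖ = 1 := by
    rw [hP, norm_smul, mul_comm Complex.I, Complex.norm_exp_ofReal_mul_I, hQn, one_mul]
  have hen : ‖e‖ = 1 := norm_basePoint n
  have heP : inner ℂ e P = ((Real.cos α : ℝ) : ℂ) + ((c * Real.sin ψ : ℝ) : ℂ) * Complex.I := by
    have h1 : (β : ℂ) + φ = ψ := by rw [hβdef]; push_cast; ring
    rw [hP, inner_smul_right, inner_basePoint, hQ, mul_left_comm, ← Complex.exp_add, ← mul_add, h1,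
      mul_comm Complex.I, Complex.exp_mul_I, hcos]
    push_cast; ring
  clear_value P
  have hee : inner ℂ e e = (1 : ℂ) := by rw [inner_self_eq_norm_sq_to_K, hen]; simp
  have hev : inner ℂ e v = Complex.I * ((c * Real.sin ψ / Real.sin α : ℝ) : ℂ) := by
    rw [hv, inner_smul_right, inner_sub_right, inner_smul_right, heP, hee, Complex.ofReal_div]
    field_simp
    ring
  have hvn : ‖v‖ = 1 := by
    have h1 : ‖P - ((Real.cos α : ℝ) : ℂ) • e‖ ^ 2 = Real.sin α ^ 2 := by
      have h2 : (inner ℂ P e).re = Real.cos α := by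
        rw [← inner_conj_symm, heP]; simp [-Complex.ofReal_cos]
      rw [norm_sub_sq (𝕜 := ℂ), inner_smul_right, norm_smul, hPn, hen, Complex.norm_real,
        RCLike.re_to_complex, Complex.re_ofReal_mul, h2, mul_one, Real.norm_eq_abs, sq_abs]
      linarith [Real.sin_sq_add_cos_sq α]
    have h3 := (sq_eq_sq₀ (norm_nonneg _) hsinpos.le).1 h1
    rw [hv, norm_smul, h3, norm_inv, Complex.norm_real, Real.norm_eq_abs, abs_of_pos hsinpos,
      inv_mul_cancel₀ hsinpos.ne']
  obtain ⟨h1, h2⟩ := isCRCurve_rotatedCircle hen hvn hev hβ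
  have hend : rotatedCircle e v α β 1 = Q := by
    rw [rotatedCircle, mul_one, mul_one, hv, smul_inv_smul₀ hsin0, add_sub_cancel, hP, smul_smul,
      ← Complex.exp_add, neg_add_cancel, Complex.exp_zero, one_smul]
  rw [hend] at h1
  exact ⟨_, h1, h2⟩

/-- The duality formula for the Carnot-Caratheodory distance, and the existence of a minimizer. -/
theorem isLeast_crLengths {n : ℕ} {Q : Space n} (hQn : ‖Q‖ = 1) {c φ ψ : ℝ} (hc0 : 0 ≤ c)
    (hc1 : c < 1) (hQ : Q 0 = c * Complex.exp (Complex.I * φ)) (hψ : axisMap c ψ = φ) :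
    IsLeast (crLengths (basePoint n) Q)
      (Real.sqrt (Real.arccos (c * Real.cos ψ) ^ 2 - (ψ - φ) ^ 2)) := by
  refine ⟨exists_isCRCurve hQn hc0 hc1 hQ hψ, ?_⟩
  rintro _ ⟨γ, hγ, rfl⟩
  refine Real.sqrt_le_iff.2 ⟨curveLength_nonneg γ, ?_⟩
  have := arccos_sq_le_curveLength_sq_add hγ hc0 hc1 hQ ψ
  linarith

/-- Since `(c sin ψ)² ≤ 1 - (c cos ψ)²`, the factor multiplying the arccosine in `axisMap` has
modulus at most one. This makes the radicand in the distance formula nonnegative. -/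
theorem axisMap_sub_sq_le {c : ℝ} (hc0 : 0 ≤ c) (hc1 : c < 1) (ψ : ℝ) :
    (ψ - axisMap c ψ) ^ 2 ≤ Real.arccos (c * Real.cos ψ) ^ 2 := by
  have hlt := abs_lt.1 (abs_mul_cos_lt_one hc0 hc1 ψ)
  have hpos : 0 < 1 - (c * Real.cos ψ) ^ 2 := by nlinarith
  have h : (c * Real.sin ψ) ^ 2 + (c * Real.cos ψ) ^ 2 = c ^ 2 := by
    linear_combination c ^ 2 * Real.sin_sq_add_cos_sq ψ
  rw [axisMap, sub_sub_cancel, div_pow, Real.sq_sqrt hpos.le, mul_pow, div_le_iff₀ hpos]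
  exact mul_le_mul_of_nonneg_left (by nlinarith) (sq_nonneg _)

end Minimizer
end CRSphere

/-! ### The distance formula. -/

theorem theorem6p14 (n : ℕ) (Q : CRSphere.Space n)
    (hQ : Q ∈ Metric.sphere (0 : CRSphere.Space n) 1)
    (ϑ₁ φ₁ : ℝ) (hϑ₀ : 0 ≤ ϑ₁) (hϑ₁ : ϑ₁ ≤ Real.pi / 2)
    (hφ₀ : -Real.pi < φ₁) (hφ₁ : φ₁ ≤ Real.pi)
    (hcoord : Q 0 = (Real.cos ϑ₁ : ℂ) * Complex.exp (Complex.I * (φ₁ : ℂ)))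
    (hϑ : ϑ₁ ≠ 0) :
    CRSphere.ccDist (CRSphere.basePoint n) Q ∈
        CRSphere.crLengths (CRSphere.basePoint n) Q ∧
    ∃ ψ : ℝ,
      CRSphere.IsCriticalPoint (CRSphere.g ϑ₁ φ₁) (Complex.I * (ψ : ℂ)) ∧
      (∀ w : ℂ, CRSphere.IsCriticalPoint (CRSphere.g ϑ₁ φ₁) w → w ≠ Complex.I * (ψ : ℂ) →
        ‖Complex.I * (ψ : ℂ)‖ < ‖w‖) ∧
      CRSphere.g ϑ₁ φ₁ (Complex.I * (ψ : ℂ)) =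
        1 / 2 * (CRSphere.ccDist (CRSphere.basePoint n) Q : ℂ) ^ 2 ∧
      CRSphere.ccDist (CRSphere.basePoint n) Q ^ 2 =
        (Real.arccos (Real.cos ϑ₁ * Real.cos ψ)) ^ 2 - (ψ - φ₁) ^ 2 := by
  have hpi := Real.pi_pos
  have hc0 : 0 ≤ Real.cos ϑ₁ := Real.cos_nonneg_of_mem_Icc ⟨by linarith, hϑ₁⟩
  have hc1 : Real.cos ϑ₁ < 1 := by
    rw [← Real.cos_zero]
    exact Real.cos_lt_cos_of_nonneg_of_le_pi le_rfl (by linarith) (lt_of_le_of_ne hϑ₀ hϑ.symm)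
  obtain ⟨ψ, hψ0, hψ1, hψ⟩ := CRSphere.exists_axisMap_eq hc0 hc1 hφ₀ hφ₁
  have hleast := CRSphere.isLeast_crLengths (mem_sphere_zero_iff_norm.1 hQ) hc0 hc1 hcoord hψ
  have hdist : CRSphere.ccDist (CRSphere.basePoint n) Q = _ := hleast.csInf_eq
  have hsq : CRSphere.ccDist (CRSphere.basePoint n) Q ^ 2 =
      Real.arccos (Real.cos ϑ₁ * Real.cos ψ) ^ 2 - (ψ - φ₁) ^ 2 := by
    rw [hdist, Real.sq_sqrt]
    have := CRSphere.axisMap_sub_sq_le hc0 hc1 ψ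
    rw [hψ] at this
    linarith
  refine ⟨hdist ▸ hleast.1, ψ, (CRSphere.isCriticalPoint_I_mul_iff hc0 hc1).2 hψ,
    fun w hw hne => CRSphere.norm_lt_of_isCriticalPoint hc0 hc1 (abs_le.2 ⟨hψ0.le, hψ1⟩) hψ hw hne,
    ?_, hsq⟩
  rw [CRSphere.g_I_mul φ₁ ψ hc0 hc1, ← hsq]
  push_cast
  rfl
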